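/- Let $G$ be a commutative-transitive discrete group, i.e. a group in which every element other than the identity has an abelian centralizer. Let $\ell^1(G)$ be its complex convolution algebra, let $\varepsilon:\ell^1(G)\to\mathbb{C}$, $\varepsilon(f)=\sum_{x\in G} f(x)$, be the augmentation character, and let $I_0(G)=\ker\varepsilon$ be the augmentation ideal, a Banach algebra with the norm and product of $\ell^1(G)$. Then $I_0(G)$ is simplicially trivial: for every $n\ge 1$ the Hochschild cohomology group $\mathcal{H}^n(I_0(G),I_0(G)')$ is zero. Here, for a Banach algebra $A$, the dual space $A'$ is the $A$-bimodule with $(a\cdot\varphi)(b)=\varphi(ba)$ and $(\varphi\cdot a)(b)=\varphi(ab)$, and $\mathcal{H}^n(A,A')=\ker(\delta:\mathcal{C}^n\to\mathcal{C}^{n+1})/\operatorname{im}(\delta:\mathcal{C}^{n-1}\to\mathcal{C}^{n})$, where $\mathcal{C}^n$ is the space of bounded $n$-linear maps from $A$ to $A'$ and $$(\delta\psi)(a_1,\dots,a_{n+1})=a_1\cdot\psi(a_2,\dots,a_{n+1})+\sum_{j=1}^n(-1)^j\psi(a_1,\dots,a_ja_{j+1},\dots,a_{n+1})+(-1)^{n+1}\psi(a_1,\dots,a_n)\cdot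 a_{n+1}.$$ -/

import Mathlib

open scoped BigOperators ENNReal

/-! ## Banach bimodules and Hochschild cohomology -/

/-- `M` is a Banach bimodule over the (possibly non-unital) normed algebra `A`: a left and a right
action of `A` on `M`, each given by a bounded bilinear map, not necessarily contractive.
`left a m` is `a · m` and `right a m` is `m · a`. -/
class BanachBimodule (A M : Type*) [NonUnitalNormedRing A] [NormedSpace ℂ A]
    [NormedAddCommGroup M] [NormedSpace ℂ M] where
  left : A →L[ℂ] M →L[ℂ] M
  right : A →L[ℂ] M →L[ℂ] M
  left_mul : ∀ (a b : A) (m : M), left (a * b) m = left a (left b m)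
  right_mul : ∀ (a b : A) (m : M), right (a * b) m = right b (right a m)
  left_right : ∀ (a b : A) (m : M), right b (left a m) = left a (right b m)

namespace BanachBimodule

/-- `A` as a bimodule over itself, by multiplication. -/
noncomputable instance regular (A : Type*) [NonUnitalNormedRing A] [NormedSpace ℂ A]
    [IsScalarTower ℂ A A] [SMulCommClass ℂ A A] : BanachBimodule A A where
  left := ContinuousLinearMap.mul ℂ A
  right := (ContinuousLinearMap.mul ℂ A).flip
  left_mul a b m := by simp [mul_assoc]
  right_mul a b m := by simp [mul_assoc]
  left_right a b m := by simp [mul_assoc]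

/-- The dual bimodule `M'`: `(a · φ) m = φ (m · a)` and `(φ · a) m = φ (a · m)`. -/
noncomputable instance dual (A M : Type*) [NonUnitalNormedRing A] [NormedSpace ℂ A]
    [NormedAddCommGroup M] [NormedSpace ℂ M] [BanachBimodule A M] :
    BanachBimodule A (StrongDual ℂ M) where
  left := (ContinuousLinearMap.compL ℂ M M ℂ).flip.comp right
  right := (ContinuousLinearMap.compL ℂ M M ℂ).flip.comp left
  left_mul a b φ := by ext m; simp [right_mul]
  right_mul a b φ := by ext m; simp [left_mul]
  left_right a b φ := by ext m; simp [left_right]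

variable {A M : Type*} [NonUnitalNormedRing A] [NormedSpace ℂ A]
  [NormedAddCommGroup M] [NormedSpace ℂ M] [BanachBimodule A M]

theorem dual_left_apply (a : A) (φ : StrongDual ℂ M) (m : M) :
    (left a φ : StrongDual ℂ M) m = φ (right a m) := rfl

theorem dual_right_apply (a : A) (φ : StrongDual ℂ M) (m : M) :
    (right a φ : StrongDual ℂ M) m = φ (left a m) := rfl

end BanachBimodule

namespace Hochschild

/-- The space `C^n(A, M)` of bounded `n`-linear maps from `A` to `M`. -/
abbrev Cochain (A M : Type*) [NonUnitalNormedRing A] [NormedSpace ℂ A]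
    [NormedAddCommGroup M] [NormedSpace ℂ M] (n : ℕ) : Type _ :=
  ContinuousMultilinearMap ℂ (fun _ : Fin n => A) M

section contract

variable {A M : Type*} [NonUnitalNormedRing A] [NormedSpace ℂ A]
  [IsScalarTower ℂ A A] [SMulCommClass ℂ A A]
  [NormedAddCommGroup M] [NormedSpace ℂ M]

/-- The position at which a change of the `i`-th entry shows up after the entries `j` and `j + 1`
have been multiplied together. -/
theorem contractNth_update {A : Type*} [Mul A] {n : ℕ} (j : Fin n) (a : Fin (n + 1) → A)
    (i : Fin (n + 1)) :
    ∃ (k : Fin n) (F : A → A), (F = id ∨ F = (· * a j.succ) ∨ F = (a j.castSucc * ·)) ∧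
      ∀ x, Fin.contractNth j.castSucc (· * ·) (Function.update a i x)
        = Function.update (Fin.contractNth j.castSucc (· * ·) a) k (F x) := by
  rcases lt_trichotomy (i : ℕ) j with h | h | h
  · refine ⟨⟨i, by omega⟩, id, Or.inl rfl, fun x => ?_⟩
    funext l
    simp only [Fin.contractNth, Function.update_apply, Fin.ext_iff, Fin.val_castSucc, Fin.val_succ]
    grind
  · refine ⟨j, (· * a j.succ), Or.inr (Or.inl rfl), fun x => ?_⟩
    funext l
    simp only [Fin.contractNth, Function.update_apply, Fin.ext_iff, Fin.val_castSucc, Fin.val_succ]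
    grind
  · by_cases h' : (i : ℕ) = j + 1
    · refine ⟨j, (a j.castSucc * ·), Or.inr (Or.inr rfl), fun x => ?_⟩
      funext l
      simp only [Fin.contractNth, Function.update_apply, Fin.ext_iff, Fin.val_castSucc,
        Fin.val_succ]
      grind
    · refine ⟨⟨i - 1, by omega⟩, id, Or.inl rfl, fun x => ?_⟩
      funext l
      simp only [Fin.contractNth, Function.update_apply, Fin.ext_iff, Fin.val_castSucc,
        Fin.val_succ]
      grind

/-- The cochain `(a₁, …, aₙ₊₁) ↦ ψ(a₁, …, aⱼ aⱼ₊₁, …, aₙ₊₁)` (with `j` counted from `0`). -/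
noncomputable def contract {n : ℕ} (ψ : Cochain A M n) (j : Fin n) : Cochain A M (n + 1) where
  toFun a := ψ (Fin.contractNth j.castSucc (· * ·) a)
  map_update_add' {inst} a i x y := by
    rw [Subsingleton.elim inst (instDecidableEqFin (n + 1))]
    obtain ⟨k, F, hF, h⟩ := contractNth_update j a i
    have : F (x + y) = F x + F y := by
      rcases hF with rfl | rfl | rfl <;> simp [mul_add, add_mul]
    simp only [h, this, ContinuousMultilinearMap.map_update_add]
  map_update_smul' {inst} a i c x := by
    rw [Subsingleton.elim inst (instDecidableEqFin (n + 1))]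
    obtain ⟨k, F, hF, h⟩ := contractNth_update j a i
    have : F (c • x) = c • F x := by
      rcases hF with rfl | rfl | rfl <;> simp [mul_smul_comm, smul_mul_assoc]
    simp only [h, this, ContinuousMultilinearMap.map_update_smul]
  cont := by
    refine ψ.cont.comp (continuous_pi fun k => ?_)
    unfold Fin.contractNth
    split_ifs <;> fun_prop

theorem contract_apply {n : ℕ} (ψ : Cochain A M n) (j : Fin n) (a : Fin (n + 1) → A) :
    contract ψ j a = ψ (Fin.contractNth j.castSucc (· * ·) a) := rfl

end contract

variable (A M : Type*) [NonUnitalNormedRing A] [NormedSpace ℂ A]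
  [IsScalarTower ℂ A A] [SMulCommClass ℂ A A]
  [NormedAddCommGroup M] [NormedSpace ℂ M] [BanachBimodule A M]

/-- The Hochschild coboundary operator `C^n(A, M) → C^{n+1}(A, M)`; its formula is
`Hochschild.coboundary_apply`. -/
noncomputable def coboundary (n : ℕ) : Cochain A M n →ₗ[ℂ] Cochain A M (n + 1) where
  toFun ψ :=
    ContinuousLinearMap.uncurryLeft
      (((ContinuousLinearMap.compContinuousMultilinearMapL ℂ (fun _ : Fin n => A) M M).flip ψ).comp
        (BanachBimodule.left : A →L[ℂ] M →L[ℂ] M))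
    + ∑ j : Fin n, (-1 : ℂ) ^ ((j : ℕ) + 1) • contract ψ j
    + (-1 : ℂ) ^ (n + 1) • ContinuousMultilinearMap.uncurryRight (Ei := fun _ => A)
        ((BanachBimodule.right : A →L[ℂ] M →L[ℂ] M).flip.compContinuousMultilinearMap ψ)
  map_add' ψ χ := by
    ext a
    simp only [map_add, contract_apply, _root_.add_apply, smul_add,
      _root_.sum_apply, _root_.smul_apply,
      Finset.sum_add_distrib, ContinuousLinearMap.uncurryLeft_apply,
      ContinuousMultilinearMap.uncurryRight_apply, ContinuousLinearMap.comp_apply,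
      ContinuousLinearMap.flip_apply, ContinuousLinearMap.compContinuousMultilinearMapL_apply,
      ContinuousLinearMap.compContinuousMultilinearMap_coe, Function.comp_apply]
    abel
  map_smul' c ψ := by
    ext a
    simp [contract_apply, Finset.smul_sum, smul_comm c]

theorem coboundary_apply {n : ℕ} (ψ : Cochain A M n) (a : Fin (n + 1) → A) :
    coboundary A M n ψ a =
      BanachBimodule.left (a 0) (ψ (fun i => a i.succ))
      + ∑ j : Fin n, (-1 : ℂ) ^ ((j : ℕ) + 1) • ψ (Fin.contractNth j.castSucc (· * ·) a)
      + (-1 : ℂ) ^ (n + 1) • BanachBimodule.right (a (Fin.last n)) (ψ (fun i => a i.castSucc)) := by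
  simp [coboundary, contract_apply]
  rfl

/-- The cocycles `Z^n(A, M)`. -/
noncomputable def cocycles (n : ℕ) : Submodule ℂ (Cochain A M n) :=
  LinearMap.ker (coboundary A M n)

/-- The coboundaries `B^n(A, M)`, with `B^0(A, M) = 0`. -/
noncomputable def coboundaries : (n : ℕ) → Submodule ℂ (Cochain A M n)
  | 0 => ⊥
  | n + 1 => LinearMap.range (coboundary A M n)

/-- The Hochschild cohomology group `H^n(A, M) = Z^n(A, M) / B^n(A, M)`. -/
abbrev Cohomology (n : ℕ) : Type _ :=
  cocycles A M n ⧸ (coboundaries A M n).submoduleOf (cocycles A M n)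

end Hochschild

/-- A Banach algebra `A` is simplicially trivial if its simplicial cohomology groups `H^n(A, A')`
vanish in every degree `n ≥ 1`. -/
def SimpliciallyTrivial (A : Type*) [NonUnitalNormedRing A] [NormedSpace ℂ A]
    [IsScalarTower ℂ A A] [SMulCommClass ℂ A A] : Prop :=
  ∀ n : ℕ, 1 ≤ n → Subsingleton (Hochschild.Cohomology A (StrongDual ℂ A) n)

/-! ## The convolution algebra of a discrete group and its augmentation ideal -/

/-- The Banach space `ℓ¹(G)`. -/
abbrev GroupL1 (G : Type*) : Type _ := lp (fun _ : G => ℂ) 1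

namespace GroupL1

variable {G : Type*}

theorem summable_norm (f : GroupL1 G) : Summable fun x => ‖f x‖ := by
  simpa using (lp.memℓp f).summable (by simp)

theorem summable_coe (f : GroupL1 G) : Summable fun x => f x :=
  (summable_norm f).of_norm

theorem norm_eq (f : GroupL1 G) : ‖f‖ = ∑' x, ‖f x‖ := by
  simp [lp.norm_eq_tsum_rpow (p := 1) (by simp) f]

variable [Group G]

/-- The bijection `(y, x) ↦ (y, y⁻¹ x)`. -/
def shear (G : Type*) [Group G] : G × G ≃ G × G where
  toFun p := (p.1, p.1⁻¹ * p.2)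
  invFun p := (p.1, p.1 * p.2)
  left_inv p := by simp
  right_inv p := by simp

theorem summable_shear (f g : GroupL1 G) :
    Summable fun p : G × G => ‖f p.1 * g (p.1⁻¹ * p.2)‖ :=
  (shear G).summable_iff.2 ((summable_norm f).mul_norm (summable_norm g))

theorem summable_shear_right (f g : GroupL1 G) (x : G) :
    Summable fun y => f y * g (y⁻¹ * x) :=
  ((summable_shear f g).comp_injective (i := fun y : G => (y, x))
    (fun _ _ h => (Prod.ext_iff.1 h).1)).of_norm

theorem tsum_shear_norm (f g : GroupL1 G) :
    ∑' x, ∑' y, ‖f y * g (y⁻¹ * x)‖ = ‖f‖ * ‖g‖ := by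
  rw [norm_eq, norm_eq, (summable_norm f).tsum_mul_tsum (summable_norm g)
      (by simpa using (summable_norm f).mul_norm (summable_norm g)),
    ← (shear G).tsum_eq]
  have h := (Equiv.prodComm G G).summable_iff.2 (summable_shear f g)
  rw [← h.tsum_prod (f := fun p : G × G => ‖f p.2 * g (p.2⁻¹ * p.1)‖) ,
    ← (Equiv.prodComm G G).tsum_eq]
  simp [shear]

theorem summable_conv_norm (f g : GroupL1 G) :
    Summable fun x => ∑' y, ‖f y * g (y⁻¹ * x)‖ :=
  ((Equiv.prodComm G G).summable_iff.2 (summable_shear f g)).prod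

theorem norm_conv_le (f g : GroupL1 G) (x : G) :
    ‖∑' y, f y * g (y⁻¹ * x)‖ ≤ ∑' y, ‖f y * g (y⁻¹ * x)‖ :=
  norm_tsum_le_tsum_norm (summable_shear_right f g x).norm

/-- Convolution: `(f * g)(x) = ∑_y f(y) g(y⁻¹ x)`. -/
noncomputable instance : Mul (GroupL1 G) where
  mul f g := ⟨fun x => ∑' y, f y * g (y⁻¹ * x), memℓp_gen (by
    simpa using Summable.of_nonneg_of_le (fun _ => norm_nonneg _) (norm_conv_le f g)
      (summable_conv_norm f g))⟩

theorem mul_apply (f g : GroupL1 G) (x : G) : (f * g) x = ∑' y, f y * g (y⁻¹ * x) := rfl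

open Classical in
/-- The unit is the point mass at the identity of `G`. -/
noncomputable instance : One (GroupL1 G) where
  one := lp.single 1 1 1

theorem one_eq [DecidableEq G] : (1 : GroupL1 G) = lp.single 1 1 1 := by
  unfold_projs
  congr!

theorem conv_assoc (f g h : GroupL1 G) : f * g * h = f * (g * h) := by
  ext x
  simp only [mul_apply]
  have key : Summable (Function.uncurry fun y z : G =>
      f z * g (z⁻¹ * y) * h (y⁻¹ * x)) := by
    have h1 := ((Equiv.prodComm G G).summable_iff.2 (summable_shear f g)).mul_left ‖h‖
    refine Summable.of_norm_bounded h1 fun p => ?_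
    have h2 := lp.norm_apply_le_norm (p := 1) one_ne_zero h (p.1⁻¹ * x)
    simp only [Function.uncurry, Function.comp, Equiv.prodComm_apply, Prod.fst_swap,
      Prod.snd_swap]
    rw [norm_mul, mul_comm]
    gcongr
  calc ∑' y, (∑' z, f z * g (z⁻¹ * y)) * h (y⁻¹ * x)
      = ∑' y, ∑' z, f z * g (z⁻¹ * y) * h (y⁻¹ * x) := by simp only [tsum_mul_right]
    _ = ∑' z, ∑' y, f z * g (z⁻¹ * y) * h (y⁻¹ * x) := key.tsum_comm.symm
    _ = ∑' z, f z * ∑' w, g w * h (w⁻¹ * (z⁻¹ * x)) := by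
        congr 1
        funext z
        rw [← tsum_mul_left, ← (Equiv.mulLeft z).tsum_eq]
        simp [mul_assoc]

noncomputable instance : NormedRing (GroupL1 G) :=
  { (inferInstance : NormedAddCommGroup (GroupL1 G)),
    (inferInstance : Mul (GroupL1 G)), (inferInstance : One (GroupL1 G)) with
    left_distrib := fun f g h => by
      ext x
      simp only [mul_apply, lp.coeFn_add, Pi.add_apply, mul_add]
      exact (summable_shear_right f g x).tsum_add (summable_shear_right f h x)
    right_distrib := fun f g h => by
      ext x
      simp only [mul_apply, lp.coeFn_add, Pi.add_apply, add_mul]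
      exact (summable_shear_right f h x).tsum_add (summable_shear_right g h x)
    zero_mul := fun f => by ext x; simp [mul_apply]
    mul_zero := fun f => by ext x; simp [mul_apply]
    mul_assoc := conv_assoc
    one_mul := fun f => by
      classical
      ext x
      rw [mul_apply, tsum_eq_single 1 (fun y hy => by simp [one_eq, lp.single_apply, hy])]
      simp [one_eq]
    mul_one := fun f => by
      classical
      ext x
      rw [mul_apply, tsum_eq_single x (fun y hy => by
        simp [one_eq, lp.single_apply, inv_mul_eq_one, hy])]
      simp [one_eq]
    norm_mul_le := fun f g => by
      rw [norm_eq (f * g), ← tsum_shear_norm]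
      exact Summable.tsum_le_tsum (norm_conv_le f g) (summable_norm (f * g))
        (summable_conv_norm f g) }

noncomputable instance : NormedAlgebra ℂ (GroupL1 G) :=
  { Algebra.ofModule
      (fun c f g => by ext x; simp [mul_apply, mul_assoc, tsum_mul_left])
      (fun c f g => by ext x; simp [mul_apply, mul_left_comm, tsum_mul_left]) with
    norm_smul_le := norm_smul_le }

/-- The augmentation character `ε : ℓ¹(G) → ℂ`, `f ↦ ∑_x f(x)`. -/
noncomputable def augmentation (G : Type*) [Group G] : GroupL1 G →ₐ[ℂ] ℂ :=
  AlgHom.ofLinearMap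
    { toFun := fun f => ∑' x, f x
      map_add' := fun f g => by
        simpa using (summable_coe f).tsum_add (summable_coe g)
      map_smul' := fun c f => by simp [tsum_mul_left] }
    (by
      classical
      simp only [LinearMap.coe_mk, AddHom.coe_mk]
      rw [tsum_eq_single 1 (fun y hy => by simp [one_eq, lp.single_apply, hy])]
      simp [one_eq])
    (fun f g => by
      simp only [LinearMap.coe_mk, AddHom.coe_mk, mul_apply]
      have h := (summable_shear f g).of_norm
      have h' : Summable (Function.uncurry fun x y : G => f y * g (y⁻¹ * x)) :=
        (Equiv.prodComm G G).summable_iff.2 h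
      rw [← h'.tsum_comm, ← tsum_mul_right]
      congr 1
      funext y
      rw [tsum_mul_left, ← (Equiv.mulLeft y⁻¹).tsum_eq (fun x => g x)]
      simp)

theorem augmentation_apply (f : GroupL1 G) : augmentation G f = ∑' x, f x := rfl

theorem augmentation_single [DecidableEq G] (x : G) :
    augmentation G (lp.single 1 x 1) = 1 := by
  rw [augmentation_apply, tsum_eq_single x (fun y hy => by simp [lp.single_apply, hy])]
  simp

/-- The augmentation ideal `I₀(G)`: the kernel of the augmentation character, as a (closed,
non-unital) subalgebra of `ℓ¹(G)` with the norm of `ℓ¹(G)`. -/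
noncomputable def augmentationIdeal (G : Type*) [Group G] :
    NonUnitalSubalgebra ℂ (GroupL1 G) where
  carrier := {f | augmentation G f = 0}
  add_mem' {f g} hf hg := by simp_all
  zero_mem' := by simp
  mul_mem' {f g} hf hg := by simp_all
  smul_mem' c f hf := by simp_all

theorem mem_augmentationIdeal {f : GroupL1 G} :
    f ∈ augmentationIdeal G ↔ augmentation G f = 0 := Iff.rfl

noncomputable instance : NormedSpace ℂ (augmentationIdeal G) where
  norm_smul_le c f := norm_smul_le c (f : GroupL1 G)

instance : CompleteSpace (augmentationIdeal G) := by
  have hc : Continuous (augmentation G) := by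
    refine AddMonoidHomClass.continuous_of_bound (augmentation G) 1 fun f => ?_
    rw [one_mul, augmentation_apply, norm_eq]
    exact norm_tsum_le_tsum_norm (summable_norm f)
  exact (isClosed_singleton.preimage hc : IsClosed {f | augmentation G f = 0}).completeSpace_coe

end GroupL1

/-- A group is commutative-transitive if every element other than the identity has an abelian
centralizer. -/
def CommutativeTransitive (G : Type*) [Group G] : Prop :=
  ∀ x : G, x ≠ 1 → ∀ a ∈ Subgroup.centralizer {x}, ∀ b ∈ Subgroup.centralizer {x}, a * b = b * a

/-! Write `δ_x` for the point mass at `x`. A cochain `ψ` on `I₀(G)` is encoded by the bounded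
function `groupCochain ψ` on `Gⁿ × G` sending `(x, s)` to `ψ(δ_{x₁} - δ₁, …, δ_{xₙ} - δ₁)(δ_s -
δ_p)` with `p = (x₁⋯xₙ)⁻¹`. This encoding commutes with the coboundaries
(`groupCoboundary_groupCochain`), and it vanishes wherever `P = x₁⋯xₙ s` equals `1`, since there `s
= p`.

The group coboundary changes `P` only by conjugation, so the locus `P = 1` splits off. Away from it
the centralizer of `P` is abelian, hence amenable, and carries an invariant mean. Transporting these
means along conjugacy classes gives norm-one means `m_P` with `m_{a⁻¹Pa}(φ) = m_P(φ(· a))`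
(`exists_equivariant_means`). Averaging a cocycle over its first entry with `m_P` is then a
contracting homotopy with no loss of norm (`exists_groupCoboundary_eq`).

The resulting bounded function extends to a cochain on `ℓ¹(G)`. Restricting that cochain to `I₀(G)`
gives a primitive of `ψ`, because cochains on `I₀(G)` are recovered from their encodings
(`restrictCochain_eq`). -/

namespace GroupL1

/-! ### Point masses and bounded multilinear extension. -/

section pointMass

variable {G : Type*}

open Classical in
/-- The point mass at `x`. -/
noncomputable def pointMass (x : G) : GroupL1 G := lp.single 1 x 1

theorem norm_pointMass (x : G) : ‖pointMass x‖ = 1 := by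
  simp [pointMass, lp.norm_single]

/-- A continuous linear map on `ℓ¹(G)` is determined by its values on point masses. -/
theorem clm_ext {E : Type*} [NormedAddCommGroup E] [NormedSpace ℂ E] {S T : GroupL1 G →L[ℂ] E}
    (h : ∀ x, S (pointMass x) = T (pointMass x)) : S = T := by
  classical
  refine lp.ext_continuousLinearMap ENNReal.one_ne_top fun x => ?_
  ext
  simpa [pointMass, Subsingleton.elim (Classical.decEq G)] using h x

/-- A bounded function from `G` to a Banach space `E` extends to a bounded linear map on
`ℓ¹(G)`. -/
theorem exists_clm_lift {E : Type*} [NormedAddCommGroup E] [NormedSpace ℂ E] [CompleteSpace E]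
    (F : G → E) {C : ℝ} (hC : 0 ≤ C) (hF : ∀ x, ‖F x‖ ≤ C) :
    ∃ L : GroupL1 G →L[ℂ] E, ‖L‖ ≤ C ∧ ∀ x, L (pointMass x) = F x := by
  have hs : ∀ f : GroupL1 G, Summable fun x => ‖f x • F x‖ := fun f =>
    Summable.of_nonneg_of_le (fun _ => norm_nonneg _)
      (fun x => by rw [norm_smul]; exact mul_le_mul_of_nonneg_left (hF x) (norm_nonneg _))
      ((summable_norm f).mul_right C)
  let L : GroupL1 G →ₗ[ℂ] E :=
    { toFun := fun f => ∑' x, f x • F x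
      map_add' := fun f g => by
        simp only [lp.coeFn_add, Pi.add_apply, add_smul]
        exact (hs f).of_norm.tsum_add (hs g).of_norm
      map_smul' := fun c f => by
        simp only [lp.coeFn_smul, Pi.smul_apply, smul_assoc, RingHom.id_apply]
        exact (hs f).of_norm.tsum_const_smul c }
  have hL : ∀ f, ‖L f‖ ≤ C * ‖f‖ := fun f => by
    refine (norm_tsum_le_tsum_norm (hs f)).trans ?_
    rw [norm_eq, mul_comm, ← tsum_mul_right]
    refine Summable.tsum_le_tsum (fun x => ?_) (hs f) ((summable_norm f).mul_right C)
    rw [norm_smul]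
    exact mul_le_mul_of_nonneg_left (hF x) (norm_nonneg _)
  refine ⟨L.mkContinuous C hL, L.mkContinuous_norm_le hC hL, fun x => ?_⟩
  classical
  change ∑' y, (pointMass x) y • F y = F x
  rw [tsum_eq_single x fun y hy => by simp [pointMass, lp.single_apply, hy]]
  simp [pointMass]

/-- A continuous multilinear map on `ℓ¹(G)` is determined by its values on point masses. -/
theorem multilinear_ext {E : Type*} [NormedAddCommGroup E] [NormedSpace ℂ E] {n : ℕ}
    {S T : ContinuousMultilinearMap ℂ (fun _ : Fin n => GroupL1 G) E}
    (h : ∀ x : Fin n → G, S (fun i => pointMass (x i)) = T (fun i => pointMass (x i))) :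
    S = T := by
  induction n with
  | zero =>
    ext a
    rw [Subsingleton.elim a fun i => pointMass (Fin.elim0 i)]
    exact h _
  | succ n ih =>
    have key : S.curryLeft = T.curryLeft := clm_ext fun x => ih fun y => by
      have h' := h (Fin.cons x y)
      have e : (fun i => pointMass ((Fin.cons x y : Fin (n + 1) → G) i))
          = Fin.cons (pointMass x) fun i => pointMass (y i) := by
        funext i; refine Fin.cases ?_ (fun j => ?_) i <;> simp
      rw [e] at h'
      simpa using h'
    ext1 a
    rw [← Fin.cons_self_tail a]
    simpa using DFunLike.congr_fun (DFunLike.congr_fun key (a 0)) (Fin.tail a)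

/-- A bounded function on `Gⁿ × G` extends to a bounded multilinear map from `ℓ¹(G)ⁿ` to the
dual of `ℓ¹(G)`. -/
theorem exists_multilinear_lift {n : ℕ} (W : (Fin n → G) → G → ℂ) {C : ℝ} (hC : 0 ≤ C)
    (hW : ∀ x s, ‖W x s‖ ≤ C) :
    ∃ T : ContinuousMultilinearMap ℂ (fun _ : Fin n => GroupL1 G) (StrongDual ℂ (GroupL1 G)),
      ‖T‖ ≤ C ∧ ∀ x s, T (fun i => pointMass (x i)) (pointMass s) = W x s := by
  induction n with
  | zero =>
    obtain ⟨L, hL, hLs⟩ := exists_clm_lift (W default) hC (hW default)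
    refine ⟨ContinuousMultilinearMap.constOfIsEmpty ℂ _ L, by simpa using hL, fun x s => ?_⟩
    simp [hLs, Subsingleton.elim x default]
  | succ n ih =>
    -- Fix the first entry and lift the rest by induction; the lifts share the bound `C`, so they
    -- extend linearly in the first entry.
    choose T hT hTs using fun g : G => ih (fun x => W (Fin.cons g x)) fun x s => hW _ s
    obtain ⟨L, hL, hLs⟩ := exists_clm_lift T hC hT
    refine ⟨L.uncurryLeft, by simpa using hL, fun x s => ?_⟩
    rw [ContinuousLinearMap.uncurryLeft_apply, hLs]
    simp only [Fin.tail_def]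
    rw [hTs]
    exact congrFun (congrArg W (Fin.cons_self_tail x)) s

end pointMass

variable {G : Type*} [Group G]

theorem one_eq_pointMass : (1 : GroupL1 G) = pointMass 1 := rfl

theorem pointMass_mul (x : G) (f : GroupL1 G) (y : G) : (pointMass x * f) y = f (x⁻¹ * y) := by
  classical
  rw [mul_apply, tsum_eq_single x fun z hz => by simp [pointMass, lp.single_apply, hz]]
  simp [pointMass]

theorem pointMass_mul_pointMass (x y : G) :
    pointMass x * pointMass y = pointMass (x * y) := by
  classical
  ext z
  rw [pointMass_mul]
  simp [pointMass, lp.single_apply, Pi.single_apply, inv_mul_eq_iff_eq_mul]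

theorem pointMass_pow (x : G) (k : ℕ) : pointMass x ^ k = pointMass (x ^ k) := by
  induction k with
  | zero => simp [one_eq_pointMass]
  | succ k ih => rw [pow_succ, pow_succ, ih, pointMass_mul_pointMass]

/-- The augmentation character as a bounded functional. -/
noncomputable def augmentationL (G : Type*) [Group G] : StrongDual ℂ (GroupL1 G) :=
  (augmentation G).toLinearMap.mkContinuous 1 fun f => by
    rw [one_mul, norm_eq]
    exact norm_tsum_le_tsum_norm (summable_norm f)

theorem augmentationL_apply (f : GroupL1 G) : augmentationL G f = augmentation G f := rfl

theorem augmentation_pointMass (x : G) : augmentation G (pointMass x) = 1 := by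
  classical
  exact augmentation_single x

/-! ### Invariant means for abelian subgroups and their transport by conjugation. -/

/-- For finitely many pairwise commuting elements of `G`, there are elements of the unit ball of
`ℓ¹(G)` with augmentation `1` that are almost invariant under right translation by them. -/
theorem exists_almost_invariant (Z : Subgroup G) (hZ : ∀ a ∈ Z, ∀ b ∈ Z, a * b = b * a)
    (F : Finset Z) {ε : ℝ} (hε : 0 < ε) :
    ∃ a : GroupL1 G, ‖a‖ ≤ 1 ∧ augmentation G a = 1 ∧
      ∀ z ∈ F, ‖a * pointMass (z : G) - a‖ ≤ ε := by
  classical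
  induction F using Finset.induction_on with
  | empty => exact ⟨1, by rw [one_eq_pointMass, norm_pointMass], by simp, by simp⟩
  | insert h F _ ih =>
    obtain ⟨a, ha, ha1, haF⟩ := ih
    -- The defect of the Cesàro average of the powers of `h` is `(tⁿ - 1) / n`, of norm at most `2 /
    -- n`.
    obtain ⟨n, hn⟩ := exists_nat_gt (2 / ε)
    have hn0 : (0 : ℝ) < n := (by positivity : 0 < 2 / ε).trans hn
    have hnc : (n : ℂ) ≠ 0 := by exact_mod_cast hn0.ne'
    let t : GroupL1 G := pointMass (h : G)
    let S : GroupL1 G := ∑ k ∈ Finset.range n, t ^ k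
    have ht : ∀ k, ‖t ^ k‖ = 1 := fun k => by rw [pointMass_pow, norm_pointMass]
    have hnorm : ‖(n : ℂ)⁻¹‖ = (n : ℝ)⁻¹ := by simp
    have hS : ‖(n : ℂ)⁻¹ • S‖ ≤ 1 := by
      rw [norm_smul, hnorm, inv_mul_le_iff₀ hn0, mul_one]
      exact (norm_sum_le _ _).trans (by simp [ht])
    have hSa : augmentation G S = n := by
      simp [S, t, augmentation_pointMass]
    -- Commutativity of `Z` lets the new average pass across the translations already handled, so
    -- their estimates survive.
    have hcomm : ∀ z : Z, S * pointMass (z : G) = pointMass (z : G) * S := fun z => by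
      simp only [S, t, Finset.sum_mul, Finset.mul_sum, pointMass_pow, pointMass_mul_pointMass]
      refine Finset.sum_congr rfl fun k _ => ?_
      rw [hZ _ (Z.pow_mem h.2 k) _ z.2]
    refine ⟨a * ((n : ℂ)⁻¹ • S), ?_, ?_, fun z hz => ?_⟩
    · exact (norm_mul_le _ _).trans (mul_le_one₀ ha (norm_nonneg _) hS)
    · rw [map_mul, map_smul, ha1, hSa, smul_eq_mul, inv_mul_cancel₀ hnc, mul_one]
    · rcases Finset.mem_insert.1 hz with rfl | hz
      · have e : a * ((n : ℂ)⁻¹ • S) * pointMass (z : G) - a * ((n : ℂ)⁻¹ • S)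
            = (n : ℂ)⁻¹ • (a * (t ^ n - 1)) := by
          rw [← geom_sum_mul t n]
          simp only [mul_smul_comm, smul_mul_assoc, mul_sub, mul_one, smul_sub, mul_assoc]
          rfl
        rw [e, norm_smul, hnorm, inv_mul_le_iff₀ hn0]
        have h1 : ‖t ^ n - 1‖ ≤ 2 := by
          refine (norm_sub_le _ _).trans ?_
          rw [ht, ← pow_zero t, ht]; norm_num
        calc ‖a * (t ^ n - 1)‖ ≤ ‖a‖ * ‖t ^ n - 1‖ := norm_mul_le _ _
          _ ≤ 1 * 2 := mul_le_mul ha h1 (norm_nonneg _) zero_le_one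
          _ ≤ n * ε := by rw [one_mul]; exact ((div_lt_iff₀ hε).1 hn).le
      · have e : a * ((n : ℂ)⁻¹ • S) * pointMass (z : G) - a * ((n : ℂ)⁻¹ • S)
            = (a * pointMass (z : G) - a) * ((n : ℂ)⁻¹ • S) := by
          rw [sub_mul, mul_assoc, mul_assoc, smul_mul_assoc, hcomm,
            ← mul_smul_comm (n : ℂ)⁻¹ (pointMass (z : G)) S]
        rw [e]
        calc _ ≤ ‖a * pointMass (z : G) - a‖ * ‖(n : ℂ)⁻¹ • S‖ := norm_mul_le _ _
          _ ≤ ε * 1 := mul_le_mul (haF z hz) hS (norm_nonneg _) hε.le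
          _ = ε := mul_one _

/-- A commutative subgroup of `G` admits a right-invariant mean on the dual of `ℓ¹(G)`. -/
theorem exists_invariant_bidual (Z : Subgroup G) (hZ : ∀ a ∈ Z, ∀ b ∈ Z, a * b = b * a) :
    ∃ m : StrongDual ℂ (StrongDual ℂ (GroupL1 G)), ‖m‖ ≤ 1 ∧ m (augmentationL G) = 1 ∧
      ∀ z ∈ Z, ∀ φ : StrongDual ℂ (GroupL1 G),
        m (φ.comp ((ContinuousLinearMap.mul ℂ (GroupL1 G)).flip (pointMass z))) = m φ := by
  classical
  choose a ha ha1 haF using fun p : Finset Z × ℕ =>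
    exists_almost_invariant Z hZ p.1 (ε := 1 / ((p.2 : ℝ) + 1)) (by positivity)
  let b : Finset Z × ℕ → WeakDual ℂ (StrongDual ℂ (GroupL1 G)) := fun p =>
    StrongDual.toWeakDual (NormedSpace.inclusionInDoubleDual ℂ (GroupL1 G) (a p))
  have hb : ∀ p φ, b p φ = φ (a p) := fun p φ => rfl
  let U : Ultrafilter (Finset Z × ℕ) := Ultrafilter.of Filter.atTop
  have hU : (U : Filter (Finset Z × ℕ)) ≤ Filter.atTop := Ultrafilter.of_le _
  -- Banach–Alaoglu: the mean is a weak-* limit of the almost invariant elements along an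
  -- ultrafilter finer than the order filter.
  obtain ⟨m, hm, hlim⟩ := (WeakDual.isCompact_closedBall
      (0 : StrongDual ℂ (StrongDual ℂ (GroupL1 G))) 1).ultrafilter_le_nhds (U.map b) (by
    rw [Filter.le_principal_iff]
    refine Filter.mem_map.2 (Filter.univ_mem' fun p => ?_)
    simp only [Set.mem_preimage, mem_closedBall_zero_iff]
    refine ContinuousLinearMap.opNorm_le_bound _ zero_le_one fun φ => ?_
    change ‖φ (a p)‖ ≤ _
    rw [one_mul]
    exact φ.le_of_opNorm_le_of_le le_rfl (ha p) |>.trans (by simp))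
  have hlim' : ∀ φ, Filter.Tendsto (fun p => φ (a p)) U (nhds (m φ)) := fun φ =>
    ((WeakDual.eval_continuous φ).tendsto m).comp hlim
  refine ⟨WeakDual.toStrongDual m, by simpa using hm, ?_, fun z hz φ => ?_⟩
  · refine tendsto_nhds_unique (hlim' (augmentationL G)) ?_
    simp only [augmentationL_apply, ha1]
    exact tendsto_const_nhds
  · change m _ = m φ
    rw [← sub_eq_zero]
    refine tendsto_nhds_unique ((hlim' _).sub (hlim' φ)) ?_
    have h0 : Filter.Tendsto (fun p : Finset Z × ℕ => ‖φ‖ * (1 / ((p.2 : ℝ) + 1)))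
        Filter.atTop (nhds 0) := by
      have h1 : Filter.Tendsto (fun p : Finset Z × ℕ => p.2) Filter.atTop Filter.atTop := by
        rw [← Filter.prod_atTop_atTop_eq]; exact Filter.tendsto_snd
      simpa using (tendsto_one_div_add_atTop_nhds_zero_nat.comp h1).const_mul ‖φ‖
    refine squeeze_zero_norm' ?_ (h0.mono_left hU)
    filter_upwards [hU (Filter.mem_atTop (({⟨z, hz⟩} : Finset Z), 0))] with p hp
    have hz' : (⟨z, hz⟩ : Z) ∈ p.1 := hp.1 (by simp)
    have h2 : ‖a p * pointMass z - a p‖ ≤ 1 / ((p.2 : ℝ) + 1) := haF p ⟨z, hz⟩ hz'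
    have h3 : φ.comp ((ContinuousLinearMap.mul ℂ (GroupL1 G)).flip (pointMass z)) (a p) - φ (a p)
        = φ (a p * pointMass z - a p) := (map_sub φ _ _).symm
    rw [h3]
    exact (φ.le_opNorm _).trans (mul_le_mul_of_nonneg_left h2 (norm_nonneg _))

/-- A commutative subgroup of `G` admits a right-invariant bounded mean on the functions on `G`,
extended linearly to unbounded functions. -/
theorem exists_invariant_mean (Z : Subgroup G) (hZ : ∀ a ∈ Z, ∀ b ∈ Z, a * b = b * a) :
    ∃ m : (G → ℂ) →ₗ[ℂ] ℂ, m 1 = 1 ∧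
      (∀ (φ : G → ℂ) (C : ℝ), (∀ x, ‖φ x‖ ≤ C) → ‖m φ‖ ≤ C) ∧
      ∀ z ∈ Z, ∀ (φ : G → ℂ) (C : ℝ), (∀ x, ‖φ x‖ ≤ C) → m (fun g => φ (g * z)) = m φ := by
  obtain ⟨m, hm, hm1, hmZ⟩ := exists_invariant_bidual Z hZ
  let R : StrongDual ℂ (GroupL1 G) →ₗ[ℂ] (G → ℂ) :=
    { toFun := fun φ x => φ (pointMass x)
      map_add' := fun _ _ => rfl
      map_smul' := fun _ _ => rfl }
  have hR : Function.Injective R := fun S T h => clm_ext fun x => congrFun h x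
  -- Bounded functions are exactly the range of `R`. An algebraic left inverse extends the mean to
  -- all functions; only its values on bounded ones matter.
  obtain ⟨g, hg⟩ := R.exists_leftInverse_of_injective (LinearMap.ker_eq_bot.2 hR)
  have hgR : ∀ φ, g (R φ) = φ := fun φ => LinearMap.congr_fun hg φ
  refine ⟨m.toLinearMap.comp g, ?_, fun φ C hC => ?_, fun z hz φ C hC => ?_⟩
  · have : R (augmentationL G) = 1 := by
      funext x; exact augmentation_pointMass x
    simp [← this, hgR, hm1]
  · have hC0 : 0 ≤ C := (norm_nonneg _).trans (hC 1)
    obtain ⟨L, hL, hLφ⟩ := exists_clm_lift φ hC0 hC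
    have : R L = φ := funext hLφ
    rw [← this, LinearMap.comp_apply, hgR]
    exact (m.le_of_opNorm_le_of_le hm hL).trans (by simp)
  · obtain ⟨L, hL, hLφ⟩ := exists_clm_lift φ ((norm_nonneg _).trans (hC 1)) hC
    have h1 : R L = φ := funext hLφ
    have h2 : R (L.comp ((ContinuousLinearMap.mul ℂ (GroupL1 G)).flip (pointMass z)))
        = fun g => φ (g * z) := by
      funext x
      change L (pointMass x * pointMass z) = _
      rw [pointMass_mul_pointMass, hLφ]
    rw [← h2, ← h1, LinearMap.comp_apply, LinearMap.comp_apply, hgR, hgR]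
    exact hmZ z hz L

/-- In a commutative-transitive group there is a uniformly bounded family of means, indexed by the
nonidentity elements, compatible with conjugation. -/
theorem exists_equivariant_means (hG : CommutativeTransitive G) :
    ∃ m : G → (G → ℂ) →ₗ[ℂ] ℂ, (∀ p, p ≠ 1 → m p 1 = 1) ∧
      (∀ p, p ≠ 1 → ∀ (φ : G → ℂ) (C : ℝ), (∀ x, ‖φ x‖ ≤ C) → ‖m p φ‖ ≤ C) ∧
      ∀ p, p ≠ 1 → ∀ (a : G) (φ : G → ℂ) (C : ℝ), (∀ x, ‖φ x‖ ≤ C) →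
        m (a⁻¹ * p * a) φ = m p (fun g => φ (g * a)) := by
  have hM : ∀ r : G, ∃ m : (G → ℂ) →ₗ[ℂ] ℂ, r ≠ 1 → m 1 = 1 ∧
      (∀ (φ : G → ℂ) (C : ℝ), (∀ x, ‖φ x‖ ≤ C) → ‖m φ‖ ≤ C) ∧
      ∀ z ∈ Subgroup.centralizer {r}, ∀ (φ : G → ℂ) (C : ℝ), (∀ x, ‖φ x‖ ≤ C) →
        m (fun g => φ (g * z)) = m φ := fun r => by
    by_cases hr : r = 1
    · exact ⟨0, fun h => absurd hr h⟩
    · obtain ⟨m, hm⟩ := exists_invariant_mean (Subgroup.centralizer {r}) (hG r hr)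
      exact ⟨m, fun _ => hm⟩
  choose M hM using hM
  -- One mean is chosen per conjugacy class, at the representative `r p`, and carried to `p` by a
  -- conjugator `c p`.
  let r : G → G := fun p => Quotient.out (ConjClasses.mk p)
  have hr : ∀ p, ∃ c, c * r p * c⁻¹ = p := fun p =>
    isConj_iff.1 (ConjClasses.mk_eq_mk_iff_isConj.1 (Quotient.out_eq (ConjClasses.mk p)))
  choose c hc using hr
  have hr1 : ∀ p, p ≠ 1 → r p ≠ 1 := fun p hp h => hp (by rw [← hc p, h]; simp)
  refine ⟨fun p => (M (r p)).comp (LinearMap.funLeft ℂ ℂ fun g => g * (c p)⁻¹), fun p hp => ?_,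
    fun p hp φ C hC => ?_, fun p hp a φ C hC => ?_⟩
  · exact (hM _ (hr1 p hp)).1
  · exact (hM _ (hr1 p hp)).2.1 _ C fun x => hC _
  · have hrq : r (a⁻¹ * p * a) = r p := by
      have : ConjClasses.mk (a⁻¹ * p * a) = ConjClasses.mk p :=
        ConjClasses.mk_eq_mk_iff_isConj.2 (isConj_iff.2 ⟨a, by group⟩)
      simp only [r, this]
    have hcq := hc (a⁻¹ * p * a)
    rw [hrq] at hcq
    have hcp := hc p
    set q := a⁻¹ * p * a with hq
    simp only [LinearMap.comp_apply, hrq]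
    -- Both `c q` and `a⁻¹ * c p` conjugate `r p` to `q`, so they differ by an element of its
    -- centralizer. Invariance under that element removes the dependence on the chosen conjugators.
    have hz : (c q)⁻¹ * a⁻¹ * c p ∈ Subgroup.centralizer {r p} := by
      rw [Subgroup.mem_centralizer_singleton_iff]
      have h1 : c q * r p * (c q)⁻¹ = a⁻¹ * (c p * r p * (c p)⁻¹) * a := by rw [hcq, hcp]
      have h2 : r p = (c q)⁻¹ * (a⁻¹ * (c p * r p * (c p)⁻¹) * a) * c q := by
        rw [← h1]; group
      generalize c q = d at *
      generalize c p = e at *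
      generalize r p = s at *
      rw [show d⁻¹ * a⁻¹ * e * s = d⁻¹ * (a⁻¹ * (e * s * e⁻¹) * a) * d * (d⁻¹ * a⁻¹ * e) by group,
        ← h2]
    refine Eq.trans ?_ ((hM _ (hr1 p hp)).2.2 _ hz (fun g => φ (g * (c p)⁻¹ * a)) C fun x => hC _)
    congr 1
    funext g
    simp only [LinearMap.funLeft_apply]
    congr 1
    group

end GroupL1

/-! ### Contraction of adjacent entries of a tuple. -/

theorem Fin.contractNth_zero_eq_cons {α : Type*} (op : α → α → α) {n : ℕ} (x : Fin (n + 2) → α) :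
    Fin.contractNth 0 op x = Fin.cons (op (x 0) (x 1)) fun i => x i.succ.succ := by
  funext k
  refine Fin.cases ?_ (fun i => ?_) k
  · simp [Fin.contractNth]
  · simp [Fin.contractNth]

theorem Fin.contractNth_succ_eq_cons {α : Type*} (op : α → α → α) {n : ℕ} (j : Fin (n + 1))
    (x : Fin (n + 2) → α) :
    Fin.contractNth j.succ op x = Fin.cons (x 0) (Fin.contractNth j op fun i => x i.succ) := by
  funext k
  refine Fin.cases ?_ (fun i => ?_) k
  · simp [Fin.contractNth]
  · simp [Fin.contractNth]

theorem Fin.prod_ofFn_contractNth {G : Type*} [Monoid G] {n : ℕ} (j : Fin n) (x : Fin (n + 1) → G) :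
    (List.ofFn (Fin.contractNth j.castSucc (· * ·) x)).prod = (List.ofFn x).prod := by
  induction n with
  | zero => exact j.elim0
  | succ n ih =>
    refine Fin.cases ?_ (fun i => ?_) j
    · rw [Fin.castSucc_zero, Fin.contractNth_zero_eq_cons]
      simp [List.ofFn_succ, mul_assoc]
    · rw [← Fin.succ_castSucc, Fin.contractNth_succ_eq_cons, List.ofFn_succ, List.ofFn_succ (f := x)]
      simp [ih]

/-! ### Vanishing of bounded group cocycles supported off the product-one locus. -/

namespace GroupL1

variable {G : Type*} [Group G]

/-- The Hochschild coboundary of a dual-valued cochain, in terms of its values on point masses. -/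
def groupCoboundary {n : ℕ} (W : (Fin n → G) → G → ℂ) (x : Fin (n + 1) → G) (s : G) : ℂ :=
  W (fun i => x i.succ) (s * x 0)
    + ∑ j : Fin n, (-1 : ℂ) ^ ((j : ℕ) + 1) * W (Fin.contractNth j.castSucc (· * ·) x) s
    + (-1 : ℂ) ^ (n + 1) * W (fun i => x i.castSucc) (x (Fin.last n) * s)

/-- In a commutative-transitive group every bounded cocycle on `Gⁿ⁺¹ × G` that vanishes on the
tuples with product `1` is the coboundary of a bounded cochain. -/
theorem exists_groupCoboundary_eq (hG : CommutativeTransitive G) {n : ℕ}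
    (u : (Fin (n + 1) → G) → G → ℂ) {C : ℝ} (hC : ∀ x s, ‖u x s‖ ≤ C)
    (hu : ∀ x s, groupCoboundary u x s = 0)
    (hu1 : ∀ x s, (List.ofFn x).prod * s = 1 → u x s = 0) :
    ∃ w : (Fin n → G) → G → ℂ, (∀ x s, ‖w x s‖ ≤ C) ∧ ∀ x s, groupCoboundary w x s = u x s := by
  classical
  obtain ⟨m, m_one, m_le, m_conj⟩ := exists_equivariant_means hG
  have hC0 : 0 ≤ C := (norm_nonneg _).trans (hC (fun _ => 1) 1)
  -- The homotopy inserts `g` in front and compensates by `s * g⁻¹`, so that the first term of the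
  -- cocycle identity no longer involves `g`. On the locus `P = 1`, where no mean is available, the
  -- value is `0`.
  let w : (Fin n → G) → G → ℂ := fun x s =>
    if (List.ofFn x).prod * s = 1 then 0
    else m ((List.ofFn x).prod * s) fun g => u (Fin.cons g x) (s * g⁻¹)
  have hw1 : ∀ x s, (List.ofFn x).prod * s = 1 → w x s = 0 := fun x s h => if_pos h
  have hw : ∀ x s, (List.ofFn x).prod * s ≠ 1 →
      w x s = m ((List.ofFn x).prod * s) fun g => u (Fin.cons g x) (s * g⁻¹) :=
    fun x s h => if_neg h
  refine ⟨w, fun x s => ?_, fun x s => ?_⟩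
  · by_cases h : (List.ofFn x).prod * s = 1
    · simpa [hw1 _ _ h] using hC0
    · rw [hw _ _ h]
      exact m_le _ h _ C fun g => hC _ _
  · set P := (List.ofFn x).prod * s with hP
    have hfirst : (List.ofFn fun i => x i.succ).prod * (s * x 0) = (x 0)⁻¹ * P * x 0 := by
      simp [hP, mul_assoc]
    have hmid : ∀ j : Fin n, (List.ofFn (Fin.contractNth j.castSucc (· * ·) x)).prod * s = P :=
      fun j => by rw [Fin.prod_ofFn_contractNth]
    have hlast : (List.ofFn fun i => x i.castSucc).prod * (x (Fin.last n) * s) = P := by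
      rw [hP, List.ofFn_succ' (f := x)]
      simp [mul_assoc]
    by_cases h : P = 1
    · rw [hu1 x s h, groupCoboundary, hw1 _ _ (by rw [hfirst, h]; simp), hw1 _ _ (hlast.trans h)]
      simp [fun j => hw1 _ _ ((hmid j).trans h)]
    · have h' : (x 0)⁻¹ * P * x 0 ≠ 1 := fun e => h (by
        rw [mul_assoc, inv_mul_eq_one] at e
        simpa using e.symm)
      -- The first term carries the mean at `(x 0)⁻¹ * P * x 0`; equivariance turns it into the mean
      -- at `P`, like all the others.
      rw [groupCoboundary, hw _ _ (by rwa [hfirst]), hw _ _ (by rwa [hlast]), hfirst, hlast,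
        m_conj P h _ _ C fun g => hC _ _]
      have hsum : ∀ j : Fin n, w (Fin.contractNth j.castSucc (· * ·) x) s
          = m P fun g => u (Fin.cons g (Fin.contractNth j.castSucc (· * ·) x)) (s * g⁻¹) :=
        fun j => by rw [hw _ _ (by rwa [hmid]), hmid]
      simp only [hsum]
      have hconst : m P (fun _ => u x s) = u x s := by
        have e : (fun _ : G => u x s) = u x s • (1 : G → ℂ) := by
          funext; simp
        rw [e, map_smul, m_one P h, smul_eq_mul, mul_one]
      rw [← hconst]
      -- Everything is now a single application of `m P`, so an identity pointwise in `g` suffices.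
      -- It is the cocycle identity at `(g, x)` and `s * g⁻¹`.
      simp only [← smul_eq_mul, ← map_smul, ← map_sum, ← map_add]
      congr 1
      funext g
      have key := hu (Fin.cons g x) (s * g⁻¹)
      rw [groupCoboundary, Fin.sum_univ_succ] at key
      simp only [Fin.cons_succ, Fin.cons_zero, Fin.castSucc_zero, Fin.contractNth_zero_eq_cons,
        ← Fin.succ_castSucc, Fin.contractNth_succ_eq_cons, inv_mul_cancel_right] at key
      have hA : (Fin.cons g x : Fin (n + 2) → G) 1 = x 0 := Fin.cons_succ (α := fun _ => G) g x 0
      have hL : (Fin.cons g x : Fin (n + 2) → G) (Fin.last (n + 1)) = x (Fin.last n) :=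
        Fin.cons_succ (α := fun _ => G) g x (Fin.last n)
      have hB : (fun i => (Fin.cons g x : Fin (n + 2) → G) (Fin.castSucc i) : Fin (n + 1) → G)
          = Fin.cons g fun i => x i.castSucc := by
        funext i
        refine Fin.cases ?_ (fun j => ?_) i <;> simp
      rw [hA, hL, hB] at key
      simp only [Fin.val_succ, pow_succ _ (_ + 1), mul_neg_one, neg_mul, Finset.sum_neg_distrib,
        Fin.val_zero, zero_add, pow_one, one_mul] at key
      simp only [smul_eq_mul, Pi.add_apply, Finset.sum_apply, Pi.smul_apply, mul_inv_rev,
        mul_assoc, mul_inv_cancel_left] at key ⊢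
      linear_combination -key

/-! ### Projections onto the augmentation ideal and the elements `δₓ - δ₁`. -/

/-- The inclusion of the augmentation ideal. -/
noncomputable def incl (G : Type*) [Group G] : augmentationIdeal G →L[ℂ] GroupL1 G where
  toFun f := f
  map_add' _ _ := rfl
  map_smul' _ _ := rfl
  cont := continuous_subtype_val

theorem sub_augmentation_smul_mem (p : G) (f : GroupL1 G) :
    f - augmentation G f • pointMass p ∈ augmentationIdeal G := by
  simp [mem_augmentationIdeal, augmentation_pointMass]

/-- The projection `f ↦ f - ε(f) δₚ` of `ℓ¹(G)` onto the augmentation ideal. -/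
noncomputable def proj (p : G) : GroupL1 G →L[ℂ] augmentationIdeal G where
  toFun f := ⟨f - augmentation G f • pointMass p, sub_augmentation_smul_mem p f⟩
  map_add' f g := Subtype.ext
    (map_add (ContinuousLinearMap.id ℂ (GroupL1 G) - (augmentationL G).smulRight (pointMass p)) f g)
  map_smul' c f := Subtype.ext
    (map_smul (ContinuousLinearMap.id ℂ (GroupL1 G) - (augmentationL G).smulRight (pointMass p)) c f)
  cont := Continuous.subtype_mk
    (ContinuousLinearMap.id ℂ (GroupL1 G) - (augmentationL G).smulRight (pointMass p)).continuous
    fun f => sub_augmentation_smul_mem p f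

theorem coe_proj (p : G) (f : GroupL1 G) :
    (proj p f : GroupL1 G) = f - augmentation G f • pointMass p := rfl

theorem proj_coe (p : G) (f : augmentationIdeal G) : proj p (f : GroupL1 G) = f := by
  apply Subtype.ext
  rw [coe_proj, mem_augmentationIdeal.1 f.2, zero_smul, sub_zero]

theorem proj_pointMass_self (p : G) : proj p (pointMass p) = 0 := by
  apply Subtype.ext
  rw [coe_proj, augmentation_pointMass, one_smul, sub_self]
  rfl

theorem norm_proj_pointMass_le (p x : G) : ‖proj p (pointMass x)‖ ≤ 2 := by
  change ‖(proj p (pointMass x) : GroupL1 G)‖ ≤ 2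
  rw [coe_proj, augmentation_pointMass, one_smul]
  refine (norm_sub_le _ _).trans ?_
  rw [norm_pointMass, norm_pointMass]; norm_num

/-- The element `δₓ - δ₁` of the augmentation ideal. -/
noncomputable abbrev diff (x : G) : augmentationIdeal G := proj 1 (pointMass x)

theorem coe_diff (x : G) : (diff x : GroupL1 G) = pointMass x - 1 := by
  rw [coe_proj, augmentation_pointMass, one_smul, one_eq_pointMass]

theorem diff_mul_diff (x y : G) : diff x * diff y = diff (x * y) - diff x - diff y := by
  apply Subtype.ext
  change (diff x : GroupL1 G) * (diff y : GroupL1 G)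
    = (diff (x * y) : GroupL1 G) - (diff x : GroupL1 G) - (diff y : GroupL1 G)
  simp only [coe_diff, ← pointMass_mul_pointMass]
  noncomm_ring

/-- The base point moves with the point mass. This is what makes the base point `(x₁⋯xₙ)⁻¹` of
`groupCochain` compatible with the outer terms of the coboundary. -/
theorem proj_pointMass_mul_diff (p x s : G) :
    proj p (pointMass s) * diff x = proj (p * x) (pointMass (s * x)) - proj p (pointMass s) := by
  apply Subtype.ext
  change (proj p (pointMass s) : GroupL1 G) * (diff x : GroupL1 G)
    = (proj (p * x) (pointMass (s * x)) : GroupL1 G) - (proj p (pointMass s) : GroupL1 G)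
  simp only [coe_proj, augmentation_pointMass, one_smul]
  simp only [← pointMass_mul_pointMass, ← one_eq_pointMass]
  noncomm_ring

theorem diff_mul_proj_pointMass (p x s : G) :
    diff x * proj p (pointMass s) = proj (x * p) (pointMass (x * s)) - proj p (pointMass s) := by
  apply Subtype.ext
  change (diff x : GroupL1 G) * (proj p (pointMass s) : GroupL1 G)
    = (proj (x * p) (pointMass (x * s)) : GroupL1 G) - (proj p (pointMass s) : GroupL1 G)
  simp only [coe_proj, augmentation_pointMass, one_smul]
  simp only [← pointMass_mul_pointMass, ← one_eq_pointMass]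
  noncomm_ring

/-- Multiplying together two adjacent entries of a tuple of elements `δₓ - δ₁`. -/
theorem contractNth_diff {n : ℕ} (j : Fin n) (x : Fin (n + 1) → G) :
    Fin.contractNth j.castSucc (· * ·) (fun i => diff (x i))
      = Function.update (fun i => diff (Fin.contractNth j.castSucc (· * ·) x i)) j
        (diff (x j.castSucc * x j.succ) - diff (x j.castSucc) - diff (x j.succ)) := by
  funext k
  rcases lt_trichotomy (k : ℕ) j with h | h | h
  · have hk : k ≠ j := fun e => h.ne (by rw [e])
    have h1 : k < j := h
    simp [Fin.contractNth, hk, h1]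
  · obtain rfl : k = j := Fin.ext h
    simp [Fin.contractNth, diff_mul_diff]
  · have hk : k ≠ j := fun e => h.ne' (by rw [e])
    have h1 : ¬k < j := fun e => h.not_gt e
    simp [Fin.contractNth, hk, h1, h.ne']

/-- Expanding `diff x * diff y` leaves two terms with a single factor; keeping the left factor
amounts to omitting entry `j + 1`. -/
theorem update_contractNth_castSucc {n : ℕ} (j : Fin n) (x : Fin (n + 1) → G) :
    Function.update (fun i => diff (Fin.contractNth j.castSucc (· * ·) x i)) j
      (diff (x j.castSucc)) = fun i => diff (x (j.succ.succAbove i)) := by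
  funext k
  rcases lt_trichotomy (k : ℕ) j with h | h | h
  · have hk : k ≠ j := fun e => h.ne (by rw [e])
    have h1 : k < j := h
    have : k.castSucc < j.succ := by rw [Fin.lt_def]; simp; omega
    simp [Fin.contractNth, hk, h1, Fin.succAbove_of_castSucc_lt _ _ this]
  · obtain rfl : k = j := Fin.ext h
    simp
  · have hk : k ≠ j := fun e => h.ne' (by rw [e])
    have h1 : ¬k < j := fun e => h.not_gt e
    have : j.succ ≤ k.castSucc := by rw [Fin.le_def]; simp; omega
    simp [Fin.contractNth, hk, h1, h.ne', Fin.succAbove_of_le_castSucc _ _ this]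

theorem update_contractNth_succ {n : ℕ} (j : Fin n) (x : Fin (n + 1) → G) :
    Function.update (fun i => diff (Fin.contractNth j.castSucc (· * ·) x i)) j
      (diff (x j.succ)) = fun i => diff (x (j.castSucc.succAbove i)) := by
  funext k
  rcases lt_trichotomy (k : ℕ) j with h | h | h
  · have hk : k ≠ j := fun e => h.ne (by rw [e])
    have h1 : k < j := h
    have : k.castSucc < j.castSucc := by rw [Fin.lt_def]; simpa
    simp [Fin.contractNth, hk, h1, Fin.succAbove_of_castSucc_lt _ _ this]
  · obtain rfl : k = j := Fin.ext h
    simp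
  · have hk : k ≠ j := fun e => h.ne' (by rw [e])
    have h1 : ¬k < j := fun e => h.not_gt e
    have : j.castSucc ≤ k.castSucc := by rw [Fin.le_def]; simp; omega
    simp [Fin.contractNth, hk, h1, h.ne', Fin.succAbove_of_le_castSucc _ _ this]

/-! ### Comparison of the two coboundaries. -/

/-- The function on `Gⁿ × G` attached to a cochain on the augmentation ideal. -/
noncomputable def groupCochain {n : ℕ}
    (ψ : Hochschild.Cochain (augmentationIdeal G) (StrongDual ℂ (augmentationIdeal G)) n)
    (x : Fin n → G) (s : G) : ℂ :=
  ψ (fun i => diff (x i)) (proj (List.ofFn x).prod⁻¹ (pointMass s))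

theorem sum_alternating_telescope {n : ℕ} (O : Fin (n + 1) → ℂ) :
    ∑ j : Fin n, (-1 : ℂ) ^ ((j : ℕ) + 1) * (O j.succ + O j.castSucc)
      = -O 0 + (-1 : ℂ) ^ n * O (Fin.last n) := by
  induction n with
  | zero => simp
  | succ n ih =>
    rw [Fin.sum_univ_castSucc]
    have := ih fun i => O i.castSucc
    simp only [Fin.val_castSucc, Fin.succ_castSucc, Fin.val_last, Fin.succ_last,
      Fin.castSucc_zero] at this ⊢
    rw [this]
    ring

theorem coboundary_dual_apply {A : Type*} [NonUnitalNormedRing A] [NormedSpace ℂ A]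
    [IsScalarTower ℂ A A] [SMulCommClass ℂ A A] {n : ℕ}
    (ψ : Hochschild.Cochain A (StrongDual ℂ A) n) (a : Fin (n + 1) → A) (b : A) :
    Hochschild.coboundary A (StrongDual ℂ A) n ψ a b =
      ψ (fun i => a i.succ) (b * a 0)
      + ∑ j : Fin n, (-1 : ℂ) ^ ((j : ℕ) + 1) * ψ (Fin.contractNth j.castSucc (· * ·) a) b
      + (-1 : ℂ) ^ (n + 1) * ψ (fun i => a i.castSucc) (a (Fin.last n) * b) := by
  rw [Hochschild.coboundary_apply]
  simp only [_root_.add_apply, _root_.sum_apply, _root_.smul_apply, smul_eq_mul]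
  rfl

/-- Since `diff` is not multiplicative, each product produces correction terms in which one entry of
`x` is omitted. Those from the inner products telescope and cancel those from the two outer terms.
-/
theorem groupCoboundary_groupCochain {n : ℕ}
    (ψ : Hochschild.Cochain (augmentationIdeal G) (StrongDual ℂ (augmentationIdeal G)) n)
    (x : Fin (n + 1) → G) (s : G) :
    groupCoboundary (groupCochain ψ) x s
      = groupCochain (Hochschild.coboundary _ _ n ψ) x s := by
  set p := (List.ofFn x).prod⁻¹ with hp
  have h0 : (List.ofFn fun i => x i.succ).prod⁻¹ = p * x 0 := by
    simp [hp]
  have h1 : (List.ofFn fun i => x i.castSucc).prod⁻¹ = x (Fin.last n) * p := by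
    rw [hp, List.ofFn_succ' (f := x)]
    simp
  obtain ⟨b, hb⟩ : ∃ b, b = proj p (pointMass s) := ⟨_, rfl⟩
  -- `O j` is the correction term with the entry `x j` omitted.
  let O : Fin (n + 1) → ℂ := fun j => ψ (fun i => diff (x (j.succAbove i))) b
  have hmid : ∀ j : Fin n, ψ (Fin.contractNth j.castSucc (· * ·) fun i => diff (x i)) b
      = ψ (fun i => diff (Fin.contractNth j.castSucc (· * ·) x i)) b
        - (O j.succ + O j.castSucc) := fun j => by
    rw [contractNth_diff, ContinuousMultilinearMap.map_update_sub,
      ContinuousMultilinearMap.map_update_sub, update_contractNth_castSucc,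
      update_contractNth_succ]
    have e : Function.update (fun i => diff (Fin.contractNth j.castSucc (· * ·) x i)) j
        (diff (x j.castSucc * x j.succ))
        = fun i => diff (Fin.contractNth j.castSucc (· * ·) x i) := by
      refine Function.update_eq_iff.2 ⟨?_, fun _ _ => rfl⟩
      simp [Fin.contractNth]
    rw [e]
    simp only [O, sub_apply]
    ring
  have hO0 : ψ (fun i => diff (x i.succ)) b = O 0 := by simp [O]
  have hOn : ψ (fun i => diff (x i.castSucc)) b = O (Fin.last n) := by simp [O]
  have hL : groupCoboundary (groupCochain ψ) x s
      = ψ (fun i => diff (x i.succ)) (b * diff (x 0)) + O 0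
        + ∑ j : Fin n, (-1 : ℂ) ^ ((j : ℕ) + 1)
          * ψ (fun i => diff (Fin.contractNth j.castSucc (· * ·) x i)) b
        + (-1 : ℂ) ^ (n + 1)
          * (ψ (fun i => diff (x i.castSucc)) (diff (x (Fin.last n)) * b) + O (Fin.last n)) := by
    simp only [groupCoboundary, groupCochain, h0, h1, Fin.prod_ofFn_contractNth, ← hp,
      proj_pointMass_mul_diff, diff_mul_proj_pointMass, hb, map_sub]
    rw [← hO0, ← hOn, hb]
    ring
  rw [hL, groupCochain, coboundary_dual_apply, ← hp, ← hb]
  simp only [hmid, mul_sub, Finset.sum_sub_distrib]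
  rw [sum_alternating_telescope O]
  ring

theorem norm_groupCochain_le {n : ℕ}
    (ψ : Hochschild.Cochain (augmentationIdeal G) (StrongDual ℂ (augmentationIdeal G)) n)
    (x : Fin n → G) (s : G) : ‖groupCochain ψ x s‖ ≤ ‖ψ‖ * 2 ^ n * 2 := by
  refine (ContinuousLinearMap.le_opNorm _ _).trans
    (mul_le_mul ?_ (norm_proj_pointMass_le _ _) (norm_nonneg _) (by positivity))
  refine (ψ.le_opNorm _).trans (mul_le_mul_of_nonneg_left ?_ (norm_nonneg _))
  simpa using Finset.prod_le_prod (s := Finset.univ) (fun i _ => norm_nonneg (diff (x i)))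
    (fun i _ => norm_proj_pointMass_le 1 (x i))

theorem groupCochain_eq_zero {n : ℕ}
    (ψ : Hochschild.Cochain (augmentationIdeal G) (StrongDual ℂ (augmentationIdeal G)) n)
    (x : Fin n → G) (s : G) (h : (List.ofFn x).prod * s = 1) : groupCochain ψ x s = 0 := by
  rw [groupCochain, inv_eq_of_mul_eq_one_right h, proj_pointMass_self, map_zero]

/-! ### Restriction from `ℓ¹(G)` and conclusion. -/

/-- The restriction of a dual-valued cochain from `ℓ¹(G)` to the augmentation ideal. -/
noncomputable def restrictCochain {n : ℕ}
    (T : Hochschild.Cochain (GroupL1 G) (StrongDual ℂ (GroupL1 G)) n) :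
    Hochschild.Cochain (augmentationIdeal G) (StrongDual ℂ (augmentationIdeal G)) n :=
  ((ContinuousLinearMap.compL ℂ (augmentationIdeal G) (GroupL1 G) ℂ).flip
    (incl G)).compContinuousMultilinearMap (T.compContinuousLinearMap fun _ => incl G)

theorem restrictCochain_apply {n : ℕ}
    (T : Hochschild.Cochain (GroupL1 G) (StrongDual ℂ (GroupL1 G)) n)
    (a : Fin n → augmentationIdeal G) (b : augmentationIdeal G) :
    restrictCochain T a b = T (fun i => (a i : GroupL1 G)) (b : GroupL1 G) := rfl

theorem coe_contractNth {n : ℕ} (j : Fin (n + 1)) (a : Fin (n + 1) → augmentationIdeal G) :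
    (fun i => ((Fin.contractNth j (· * ·) a i : augmentationIdeal G) : GroupL1 G))
      = Fin.contractNth j (· * ·) fun i => (a i : GroupL1 G) :=
  Fin.comp_contractNth (f := ((↑) : augmentationIdeal G → GroupL1 G)) (· * ·) (· * ·)
    (fun _ _ => rfl) j a

theorem coboundary_restrictCochain {n : ℕ}
    (T : Hochschild.Cochain (GroupL1 G) (StrongDual ℂ (GroupL1 G)) n) :
    Hochschild.coboundary _ _ n (restrictCochain T)
      = restrictCochain (Hochschild.coboundary _ _ n T) := by
  ext a b
  simp only [coboundary_dual_apply, restrictCochain_apply, coe_contractNth]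
  rfl

theorem coboundary_pointMass {n : ℕ}
    (T : Hochschild.Cochain (GroupL1 G) (StrongDual ℂ (GroupL1 G)) n)
    (x : Fin (n + 1) → G) (s : G) :
    Hochschild.coboundary _ _ n T (fun i => pointMass (x i)) (pointMass s)
      = groupCoboundary (fun y t => T (fun i => pointMass (y i)) (pointMass t)) x s := by
  have h : ∀ j : Fin n, Fin.contractNth j.castSucc (· * ·) (fun i => pointMass (x i))
      = fun i => pointMass (Fin.contractNth j.castSucc (· * ·) x i) := fun j =>
    (Fin.comp_contractNth (· * ·) (· * ·) (fun a b => (pointMass_mul_pointMass a b).symm) _ x).symm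
  simp only [coboundary_dual_apply, groupCoboundary, pointMass_mul_pointMass, h]

/-- A cochain on the augmentation ideal is the restriction of any cochain on `ℓ¹(G)` that takes
the same values on the associated tuples of point masses. -/
theorem restrictCochain_eq {n : ℕ}
    (T : Hochschild.Cochain (GroupL1 G) (StrongDual ℂ (GroupL1 G)) n)
    (ψ : Hochschild.Cochain (augmentationIdeal G) (StrongDual ℂ (augmentationIdeal G)) n)
    (h : ∀ x s, T (fun i => pointMass (x i)) (pointMass s) = groupCochain ψ x s) :
    restrictCochain T = ψ := by
  let R : (GroupL1 G →L[ℂ] ℂ) →L[ℂ] (augmentationIdeal G →L[ℂ] ℂ) :=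
    (ContinuousLinearMap.compL ℂ (augmentationIdeal G) (GroupL1 G) ℂ).flip (incl G)
  have key : R.compContinuousMultilinearMap T = ψ.compContinuousLinearMap fun _ => proj 1 := by
    refine multilinear_ext (E := StrongDual ℂ (augmentationIdeal G)) fun x => ?_
    -- The base point depends on `x`, but every `proj p` fixes the ideal pointwise, so the
    -- dependence disappears on `b`.
    have hx : T (fun i => pointMass (x i))
        = (ψ fun i => diff (x i)).comp (proj (List.ofFn x).prod⁻¹) := clm_ext fun s => h x s
    ext b
    change T (fun i => pointMass (x i)) (b : GroupL1 G) = ψ (fun i => diff (x i)) b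
    rw [hx, ContinuousLinearMap.comp_apply, proj_coe]
  ext a b
  have h1 := DFunLike.congr_fun (DFunLike.congr_fun key fun i => (a i : GroupL1 G)) b
  refine h1.trans ?_
  change ψ (fun i => proj 1 (a i : GroupL1 G)) b = ψ a b
  simp only [proj_coe]

theorem exists_coboundary_eq (hG : CommutativeTransitive G) {n : ℕ}
    (ψ : Hochschild.Cochain (augmentationIdeal G) (StrongDual ℂ (augmentationIdeal G)) (n + 1))
    (hψ : Hochschild.coboundary _ _ (n + 1) ψ = 0) :
    ∃ χ, Hochschild.coboundary _ _ n χ = ψ := by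
  obtain ⟨w, hwC, hw⟩ := exists_groupCoboundary_eq hG (groupCochain ψ) (norm_groupCochain_le ψ)
    (fun x s => by rw [groupCoboundary_groupCochain, hψ]; rfl) (groupCochain_eq_zero ψ)
  obtain ⟨T, -, hT⟩ := exists_multilinear_lift w (by positivity) hwC
  refine ⟨restrictCochain T, ?_⟩
  rw [coboundary_restrictCochain]
  -- It is enough that the coboundary of `T` agree with `groupCochain ψ` on point masses, where `T`
  -- is given by `w`.
  refine restrictCochain_eq _ ψ fun x s => ?_
  rw [coboundary_pointMass]
  simp only [hT]
  exact hw x s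

end GroupL1

theorem mainTheorem4 (G : Type*) [Group G] (hG : CommutativeTransitive G) :
    SimpliciallyTrivial (GroupL1.augmentationIdeal G) := by
  rintro (_ | n) hn
  · omega
  · rw [Submodule.Quotient.subsingleton_iff, Submodule.eq_top_iff']
    rintro ⟨ψ, hψ⟩
    exact GroupL1.exists_coboundary_eq hG ψ hψ
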